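/- Let $d\ge 1$, let $\mathbb R^d$ carry a fixed norm with metric $d(\cdot,\cdot)$, and let $r\in(0,\infty)$. For a Borel probability measure $P$ on $\mathbb R^d$ and $n\in\mathbb N$ put $$V_{n,r}(P)=\inf\Big\{\int d(x,\alpha)^r\,dP(x):\alpha\subset\mathbb R^d,\ \operatorname{card}(\alpha)\le n\Big\},$$ $$\underline D_r(P)=\liminf_{n\to\infty}\frac{r\log n}{-\log V_{n,r}(P)},\qquad \overline D_r(P)=\limsup_{n\to\infty}\frac{r\log n}{-\log V_{n,r}(P)},$$ the quotient being $0$ where $V_{n,r}(P)=0$. Let $N\ge 1$, let $S_1,\dots,S_N:\mathbb R^d\to\mathbb R^d$ satisfy $s_i\,d(x,y)\le d(S_i(x),S_i(y))\le c_i\,d(x,y)$ for all $x,y$, where $0<s_i\le c_i<1$; let $(p_0,p_1,\dots,p_N)$ be a probability vector with all $p_i>0$; let $C\subset\mathbb R^d$ be compact and let $\nu$ be a Borel probability measure with $\nu(C)=1$. Let $\mu$ be the condensation measure of this system, that is, the Borel probability measure with $\mu=p_0\nu+\sum_{i=1}^N p_i\,\mu\circ S_i^{-1}$, and let $K$ be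 the compact set with $K=\bigcup_{i=1}^N S_i(K)\cup C$. Assume the strong separation condition: $S_1(K),\dots,S_N(K),C$ are pairwise disjoint. (a) There is a unique $k_r\in[0,\infty)$ with $\sum_{i=1}^N(p_is_i^r)^{\frac{k_r}{r+k_r}}=1$, and $$\max\{k_r,\underline D_r(\nu)\}\le\underline D_r(\mu).$$ (b) Suppose moreover that $\nu=\sum_{j=1}^M t_j\,\nu\circ g_j^{-1}$, where $(t_1,\dots,t_M)$ is a probability vector with all $t_j>0$ and $g_1,\dots,g_M:\mathbb R^d\to\mathbb R^d$ satisfy $d(g_j(x),g_j(y))\le r_j\,d(x,y)$ for all $x,y$, with $0<r_j<1$, together with the strong open set condition: there is a bounded nonempty open set $U$ with $g_j(U)\subseteq U$ for all $j$, $g_i(U)\cap g_j(U)=\emptyset$ for $i\ne j$, and $U\cap A\neq\emptyset$, where $A$ is the nonempty compact set with $A=\bigcup_j g_j(A)$. Then there are unique $l_r,d_r\in[0,\infty)$ with $\sum_{i=1}^N(p_ic_i^r)^{\frac{l_r}{r+l_r}}=1$ and $\sum_{j=1}^M(t_jr_j^r)^{\frac{d_r}{r+d_r}}=1$, and $$\overline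 D_r(\mu)\le\max\{l_r,d_r\}.$$ -/

import Mathlib

open MeasureTheory Filter
open scoped ENNReal

noncomputable section

namespace CondQuant

variable {E : Type*} [NormedAddCommGroup E]

/-- The `n`th quantization error of order `r` of `P`: the infimum of `∫ d(x, α) ^ r dP(x)` over all
sets `α` with at most `n` points. The distance to the empty set is `∞`, so that (for `r > 0` and
`P ≠ 0`) the empty set never competes. -/
def quantError [MeasurableSpace E] (r : ℝ) (P : Measure E) (n : ℕ) : ℝ≥0∞ :=
  ⨅ (α : Finset E) (_ : α.card ≤ n), ∫⁻ x, (Metric.infEDist x (α : Set E)) ^ r ∂P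

/-- The quotient `r log n / (- log V_{n,r}(P))`. If `V_{n,r}(P) = 0`, so that `- log V_{n,r}(P) = ∞`,
its value is `0`. -/
def quantRatio [MeasurableSpace E] (r : ℝ) (P : Measure E) (n : ℕ) : ℝ :=
  r * Real.log n / (-Real.log (quantError r P n).toReal)

/-- The lower quantization dimension of order `r`. -/
def lowerQuantDim [MeasurableSpace E] (r : ℝ) (P : Measure E) : EReal :=
  liminf (fun n : ℕ => (quantRatio r P n : EReal)) atTop

/-- The upper quantization dimension of order `r`. -/
def upperQuantDim [MeasurableSpace E] (r : ℝ) (P : Measure E) : EReal :=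
  limsup (fun n : ℕ => (quantRatio r P n : EReal)) atTop

/-- A probability vector with positive entries. -/
def IsProbVector {ι : Type*} [Fintype ι] (p : ι → ℝ) : Prop :=
  (∀ i, 0 < p i) ∧ ∑ i, p i = 1

/-- `μ = p₀ ν + ∑ pᵢ μ ∘ Sᵢ⁻¹`, where `p = (p₀, p₁, …, p_N)`. -/
def IsCondensationMeasure [MeasurableSpace E] {N : ℕ} (S : Fin N → E → E) (p : Fin (N + 1) → ℝ)
    (ν μ : Measure E) : Prop :=
  μ = ENNReal.ofReal (p 0) • ν + ∑ i : Fin N, ENNReal.ofReal (p i.succ) • μ.map (S i)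

/-- `ν = ∑ tⱼ ν ∘ gⱼ⁻¹`. -/
def IsInvariantMeasure [MeasurableSpace E] {M : ℕ} (g : Fin M → E → E) (t : Fin M → ℝ)
    (ν : Measure E) : Prop :=
  ν = ∑ j : Fin M, ENNReal.ofReal (t j) • ν.map (g j)

/-- `K` is the attractor of the system with maps `Sᵢ` and condensation set `C`: the compact set
with `K = ⋃ Sᵢ(K) ∪ C` (unique for contractions `Sᵢ` and a nonempty compact `C`). -/
def IsCondensationAttractor {N : ℕ} (S : Fin N → E → E) (C K : Set E) : Prop :=
  IsCompact K ∧ K = (⋃ i, S i '' K) ∪ C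

/-- The strong separation condition: `S₁(K), …, S_N(K)` and `C` are pairwise disjoint, where `K` is
the attractor of the condensation system. -/
def StrongSeparation {N : ℕ} (S : Fin N → E → E) (C : Set E) : Prop :=
  ∃ K, IsCondensationAttractor S C K ∧
    (∀ i j, i ≠ j → Disjoint (S i '' K) (S j '' K)) ∧ ∀ i, Disjoint (S i '' K) C

/-- `A` is the attractor of the iterated function system `g`. -/
def IsAttractor {M : ℕ} (g : Fin M → E → E) (A : Set E) : Prop :=
  A.Nonempty ∧ IsCompact A ∧ A = ⋃ j, g j '' A

/-- The strong open set condition: the open set condition holds with an open set that meets the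
attractor. -/
def StrongOpenSetCondition {M : ℕ} (g : Fin M → E → E) : Prop :=
  ∃ U : Set E, IsOpen U ∧ Bornology.IsBounded U ∧ U.Nonempty ∧
    (∀ j, g j '' U ⊆ U) ∧ (∀ i j, i ≠ j → Disjoint (g i '' U) (g j '' U)) ∧
    ∃ A, IsAttractor g A ∧ (U ∩ A).Nonempty

/-- `k ≥ 0` solves `∑ (pᵢ aᵢ ^ r) ^ (k / (r + k)) = 1`. -/
def IsDimSolution {N : ℕ} (r : ℝ) (p a : Fin N → ℝ) (k : ℝ) : Prop :=
  0 ≤ k ∧ ∑ i, (p i * a i ^ r) ^ (k / (r + k)) = 1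

end CondQuant

end

/-! Fix `D > 0` and put `e = r / D`, so that `D / (r + D) = (1 + e)⁻¹`; a bound of order
`n ^ (-e)` on the quantization error `V n` bounds the quantization dimension by `D`.

Upper bound. Quantizing each term of `m = m₀ + ∑ pᵢ m ∘ Sᵢ⁻¹` separately gives
`V (n₀ + ∑ nᵢ) ≤ V₀ n₀ + ∑ pᵢ cᵢ ^ r * V nᵢ`. Take `nᵢ = ⌊θᵢ x⌋` with
`θᵢ = (pᵢ cᵢ ^ r) ^ (1 + e)⁻¹` and `n₀ = ⌊τ x⌋` with `τ = 1 - ∑ θᵢ`, which is positive as soon as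
`D` exceeds the dimension of the system. Since `θᵢ ^ (1 + e) * (θᵢ x) ^ (-e) = θᵢ x ^ (-e)`, the
decay `O(x ^ (-e))` propagates from the scales `θᵢ x` to the scale `x`. This is applied first to
`ν`, with `m₀ = 0`, and then to `μ`, with `m₀ = p₀ ν`.

Lower bound. By strong separation a center is close to at most one of the pieces `Sᵢ(K)`, so a
quantizer `F` of `μ` splits into quantizers `Fᵢ` of the copies of `μ`. Pulling `Fᵢ` back along `Sᵢ`
costs a factor `sᵢ ^ r`, but the centers need not lie in the range of `Sᵢ`; only their distance
functions `f` with `edist x y ≤ f x + f y` are pulled back. With `I F` the integral of the `r`th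
power of the truncated distance to `F` and `∑ θᵢ = 1`, the inequality
`κ x ^ (-e) ≤ I F + κ x ^ (-(1 + e)) * |F|` propagates from the scales `θᵢ x` to the scale `x`:
because the penalty is linear in `|F|` with a slope common to all pieces, nothing has to be known
about how the centers are distributed. Taking `x = 2 n` bounds `V n` from below. -/

namespace CondQuant

open scoped NNReal Topology

section DimensionEquation

lemma strictAnti_sum_rpow {ι : Type*} [Fintype ι] [Nonempty ι] {b : ι → ℝ} (hb0 : ∀ i, 0 < b i)
    (hb1 : ∀ i, b i < 1) : StrictAnti fun q : ℝ => ∑ i, b i ^ q := fun _ _ h =>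
  Finset.sum_lt_sum_of_nonempty Finset.univ_nonempty
    fun i _ => Real.rpow_lt_rpow_of_exponent_gt (hb0 i) (hb1 i) h

lemma lt_one_of_sum_lt_one {ι : Type*} [Fintype ι] {b : ι → ℝ} (hb0 : ∀ i, 0 ≤ b i)
    (hb : ∑ i, b i < 1) (i : ι) : b i < 1 :=
  (Finset.single_le_sum (fun j _ => hb0 j) (Finset.mem_univ i)).trans_lt hb

lemma existsUnique_sum_rpow_eq_one {ι : Type*} [Fintype ι] [Nonempty ι] {b : ι → ℝ}
    (hb0 : ∀ i, 0 < b i) (hb : ∑ i, b i < 1) :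
    ∃! q : ℝ, q ∈ Set.Ico 0 1 ∧ ∑ i, b i ^ q = 1 := by
  have hanti := strictAnti_sum_rpow hb0 (lt_one_of_sum_lt_one (fun i => (hb0 i).le) hb)
  have hcont : Continuous fun q : ℝ => ∑ i, b i ^ q :=
    continuous_finsetSum _ fun i _ => Real.continuous_const_rpow (hb0 i).ne'
  have hmem : (1 : ℝ) ∈ Set.Icc (∑ i, b i ^ (1 : ℝ)) (∑ i, b i ^ (0 : ℝ)) := by
    simpa [Nat.one_le_iff_ne_zero] using hb.le
  obtain ⟨q, ⟨hq0, hq1⟩, hq⟩ := intermediate_value_Icc' zero_le_one hcont.continuousOn hmem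
  have hq_ne : q ≠ 1 := by
    rintro rfl
    simp only [Real.rpow_one] at hq
    exact hb.ne hq
  exact ⟨q, ⟨⟨hq0, hq1.lt_of_ne hq_ne⟩, hq⟩, fun q' hq' => hanti.injective (hq'.2.trans hq.symm)⟩

lemma div_add_eq_iff {r k q : ℝ} (hr : 0 < r) (hk : 0 ≤ k) (hq : q < 1) :
    k / (r + k) = q ↔ k = r * q / (1 - q) := by
  rw [div_eq_iff (by positivity), eq_div_iff (sub_pos.2 hq).ne']
  constructor <;> intro h <;> linarith

variable {N : ℕ} {r : ℝ} {p a : Fin N → ℝ}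

lemma sum_mul_rpow_lt_one (hr : 0 < r) (hN : 1 ≤ N) (hp : ∀ i, 0 < p i) (hp1 : ∑ i, p i ≤ 1)
    (ha : ∀ i, 0 < a i) (ha1 : ∀ i, a i < 1) : ∑ i, p i * a i ^ r < 1 := by
  have : NeZero N := ⟨by lia⟩
  exact (Finset.sum_lt_sum_of_nonempty Finset.univ_nonempty fun i _ =>
    mul_lt_of_lt_one_right (hp i) (Real.rpow_lt_one (ha i).le (ha1 i) hr)).trans_le hp1

lemma existsUnique_isDimSolution (hr : 0 < r) (hN : 1 ≤ N) (hp : ∀ i, 0 < p i)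
    (hp1 : ∑ i, p i ≤ 1) (ha : ∀ i, 0 < a i) (ha1 : ∀ i, a i < 1) :
    ∃! k : ℝ, IsDimSolution r p a k := by
  have : NeZero N := ⟨by lia⟩
  obtain ⟨q, ⟨⟨hq0, hq1⟩, hq⟩, hq_unique⟩ := existsUnique_sum_rpow_eq_one
    (fun i => mul_pos (hp i) (Real.rpow_pos_of_pos (ha i) r))
    (sum_mul_rpow_lt_one hr hN hp hp1 ha ha1)
  have hk0 : 0 ≤ r * q / (1 - q) := div_nonneg (by positivity) (sub_nonneg.2 hq1.le)
  refine ⟨r * q / (1 - q), ⟨hk0, ?_⟩, fun k hk => ?_⟩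
  · rwa [(div_add_eq_iff hr hk0 hq1).2 rfl]
  · have hlt : k / (r + k) < 1 := (div_lt_one (by linarith [hk.1])).2 (by linarith)
    exact (div_add_eq_iff hr hk.1 hq1).1
      (hq_unique _ ⟨⟨div_nonneg hk.1 (by linarith [hk.1]), hlt⟩, hk.2⟩)

lemma IsDimSolution.sum_rpow_lt_one {k D : ℝ} (hk : IsDimSolution r p a k) (hr : 0 < r)
    (hN : 1 ≤ N) (hp : ∀ i, 0 < p i) (hp1 : ∑ i, p i ≤ 1) (ha : ∀ i, 0 < a i)
    (ha1 : ∀ i, a i < 1) (hkD : k < D) : ∑ i, (p i * a i ^ r) ^ (D / (r + D)) < 1 := by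
  have : NeZero N := ⟨by lia⟩
  have hb0 : ∀ i, 0 < p i * a i ^ r := fun i => mul_pos (hp i) (Real.rpow_pos_of_pos (ha i) r)
  have hexp : k / (r + k) < D / (r + D) := by
    have := hk.1
    rw [div_lt_div_iff₀ (by linarith) (by linarith)]
    nlinarith
  exact (strictAnti_sum_rpow hb0 (lt_one_of_sum_lt_one (fun i => (hb0 i).le)
    (sum_mul_rpow_lt_one hr hN hp hp1 ha ha1)) hexp).trans_eq hk.2

end DimensionEquation

section QuantDim

variable {E : Type*} [NormedAddCommGroup E] [MeasurableSpace E] {r : ℝ} {P : Measure E}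

lemma tendsto_mul_log_natCast (hr : 0 < r) :
    Tendsto (fun n : ℕ => r * Real.log n) atTop atTop :=
  (Real.tendsto_log_atTop.comp tendsto_natCast_atTop_atTop).const_mul_atTop hr

lemma toReal_quantError_pos {n : ℕ} (h1 : quantError r P n < 1) (h0 : quantError r P n ≠ 0) :
    0 < (quantError r P n).toReal :=
  ENNReal.toReal_pos h0 (h1.trans ENNReal.one_lt_top).ne

lemma neg_log_quantError_pos {n : ℕ} (h1 : quantError r P n < 1) (h0 : quantError r P n ≠ 0) :
    0 < -Real.log (quantError r P n).toReal :=
  neg_pos.2 (Real.log_neg (toReal_quantError_pos h1 h0)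
    (ENNReal.toReal_lt_of_lt_ofReal (by simpa using h1)))

lemma quantRatio_of_quantError_eq_zero {n : ℕ} (h0 : quantError r P n = 0) :
    quantRatio r P n = 0 := by
  simp [quantRatio, h0]

lemma quantRatio_nonneg (hr : 0 < r) {n : ℕ} (h1 : quantError r P n < 1) :
    0 ≤ quantRatio r P n := by
  rcases eq_or_ne (quantError r P n) 0 with h0 | h0
  · exact (quantRatio_of_quantError_eq_zero h0).ge
  · exact div_nonneg (mul_nonneg hr.le (Real.log_natCast_nonneg n))
      (neg_log_quantError_pos h1 h0).le

lemma lowerQuantDim_nonneg (hr : 0 < r) (h1 : ∀ᶠ n in atTop, quantError r P n < 1) :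
    0 ≤ lowerQuantDim r P := by
  refine le_liminf_of_le (by isBoundedDefault) ?_
  filter_upwards [h1] with n hn
  exact_mod_cast quantRatio_nonneg hr hn

lemma coe_le_lowerQuantDim (hr : 0 < r) (h1 : ∀ᶠ n in atTop, quantError r P n < 1) {k b : ℝ}
    (hk : 0 < k) (h : ∀ᶠ n : ℕ in atTop, quantError r P n ≠ 0 ∧
      k * -Real.log (quantError r P n).toReal ≤ r * Real.log n + b) :
    (k : EReal) ≤ lowerQuantDim r P := by
  refine EReal.ge_of_forall_gt_iff_ge.1 fun z hz => ?_
  have hzk : z < k := by exact_mod_cast hz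
  rcases le_or_gt z 0 with hz0 | hz0
  · exact (EReal.coe_nonpos.2 hz0).trans (lowerQuantDim_nonneg hr h1)
  refine le_liminf_of_le (by isBoundedDefault) ?_
  have hlog : ∀ᶠ n : ℕ in atTop, z * b ≤ (k - z) * (r * Real.log n) :=
    ((tendsto_mul_log_natCast hr).const_mul_atTop (sub_pos.2 hzk)).eventually_ge_atTop _
  filter_upwards [h1, h, hlog] with n hn1 ⟨hn0, hn⟩ hnb
  rw [EReal.coe_le_coe_iff, quantRatio, le_div_iff₀ (neg_log_quantError_pos hn1 hn0)]
  refine le_of_mul_le_mul_left ?_ hk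
  calc k * (z * -Real.log (quantError r P n).toReal)
      = z * (k * -Real.log (quantError r P n).toReal) := by ring
    _ ≤ z * (r * Real.log n + b) := by gcongr
    _ ≤ k * (r * Real.log n) := by linarith

lemma upperQuantDim_le_coe (hr : 0 < r) (h1 : ∀ᶠ n in atTop, quantError r P n < 1) {k b : ℝ}
    (hk : 0 < k) (h : ∀ᶠ n : ℕ in atTop, quantError r P n ≠ 0 →
      r * Real.log n ≤ k * -Real.log (quantError r P n).toReal + b) :
    upperQuantDim r P ≤ k := by
  refine EReal.le_of_forall_lt_iff_le.1 fun z hz => ?_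
  have hkz : k < z := by exact_mod_cast hz
  refine limsup_le_of_le (by isBoundedDefault) ?_
  have hlog : ∀ᶠ n : ℕ in atTop, z * b ≤ (z - k) * (r * Real.log n) :=
    ((tendsto_mul_log_natCast hr).const_mul_atTop (sub_pos.2 hkz)).eventually_ge_atTop _
  filter_upwards [h1, h, hlog] with n hn1 hn hnb
  rw [EReal.coe_le_coe_iff]
  rcases eq_or_ne (quantError r P n) 0 with h0 | h0
  · exact (quantRatio_of_quantError_eq_zero h0).trans_le (hk.trans hkz).le
  rw [quantRatio, div_le_iff₀ (neg_log_quantError_pos hn1 h0)]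
  refine le_of_mul_le_mul_left ?_ hk
  calc k * (r * Real.log n) ≤ z * (r * Real.log n - b) := by linarith
    _ ≤ z * (k * -Real.log (quantError r P n).toReal) := by
      have := hk.trans hkz
      gcongr
      linarith [hn h0]
    _ = k * (z * -Real.log (quantError r P n).toReal) := by ring

lemma coe_le_lowerQuantDim_of_rpow_le (hr : 0 < r) (h1 : ∀ᶠ n in atTop, quantError r P n < 1)
    {k : ℝ} (hk : 0 < k) {κ : ℝ≥0} (hκ : 0 < κ)
    (h : ∀ᶠ n : ℕ in atTop, ((κ * (n : ℝ≥0) ^ (-(r / k)) : ℝ≥0) : ℝ≥0∞) ≤ quantError r P n) :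
    (k : EReal) ≤ lowerQuantDim r P := by
  refine coe_le_lowerQuantDim hr h1 (b := k * -Real.log κ) hk ?_
  filter_upwards [h1, h, eventually_gt_atTop 0] with n hn1 hn hn0
  have hpos : 0 < κ * (n : ℝ≥0) ^ (-(r / k)) := by positivity
  refine ⟨((ENNReal.coe_pos.2 hpos).trans_le hn).ne', ?_⟩
  have hle : (κ * (n : ℝ) ^ (-(r / k)) : ℝ) ≤ (quantError r P n).toReal := by
    simpa using ENNReal.toReal_mono (hn1.trans ENNReal.one_lt_top).ne hn
  have hlog := Real.log_le_log (by positivity) hle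
  rw [Real.log_mul (by positivity) (by positivity), Real.log_rpow (by positivity)] at hlog
  calc k * -Real.log (quantError r P n).toReal
      ≤ k * -(Real.log κ + -(r / k) * Real.log n) := by gcongr
    _ = r * Real.log n + k * -Real.log κ := by field_simp; ring

lemma upperQuantDim_le_coe_of_le_rpow (hr : 0 < r) (h1 : ∀ᶠ n in atTop, quantError r P n < 1)
    {k : ℝ} (hk : 0 < k) {B : ℝ≥0} (hB : 0 < B)
    (h : ∀ᶠ n : ℕ in atTop, quantError r P n ≤ ((B * (n : ℝ≥0) ^ (-(r / k)) : ℝ≥0) : ℝ≥0∞)) :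
    upperQuantDim r P ≤ k := by
  refine upperQuantDim_le_coe hr h1 (b := k * Real.log B) hk ?_
  filter_upwards [h1, h, eventually_gt_atTop 0] with n hn1 hn hn0 hV
  have hle : (quantError r P n).toReal ≤ (B * (n : ℝ) ^ (-(r / k)) : ℝ) := by
    simpa using ENNReal.toReal_mono ENNReal.coe_ne_top hn
  have hlog := Real.log_le_log (toReal_quantError_pos hn1 hV) hle
  rw [Real.log_mul (by positivity) (by positivity), Real.log_rpow (by positivity)] at hlog
  calc r * Real.log n = k * -(Real.log B + -(r / k) * Real.log n) + k * Real.log B := by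
        field_simp; ring
    _ ≤ k * -Real.log (quantError r P n).toReal + k * Real.log B := by gcongr

end QuantDim

section QuantError

lemma infEDist_image_le {X Y : Type*} [PseudoEMetricSpace X] [PseudoEMetricSpace Y] {c : ℝ≥0}
    (hc : c ≠ 0) {S : X → Y} (hS : LipschitzWith c S) (x : X) (α : Set X) :
    Metric.infEDist (S x) (S '' α) ≤ c * Metric.infEDist x α := by
  simp only [Metric.infEDist, ENNReal.mul_iInf_of_ne (ENNReal.coe_ne_zero.2 hc) ENNReal.coe_ne_top]
  exact le_iInf₂ fun y hy => (iInf₂_le (S y) (Set.mem_image_of_mem S hy)).trans (hS x y)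

variable {E : Type*} [NormedAddCommGroup E] [MeasurableSpace E] {r : ℝ}

lemma quantError_le_lintegral (P : Measure E) {n : ℕ} {α : Finset E} (h : α.card ≤ n) :
    quantError r P n ≤ ∫⁻ x, Metric.infEDist x (α : Set E) ^ r ∂P :=
  iInf₂_le α h

lemma quantError_antitone (P : Measure E) : Antitone (quantError r P) := fun _ _ h =>
  le_iInf₂ fun _ hα => quantError_le_lintegral P (hα.trans h)

lemma quantError_mono {P Q : Measure E} (h : P ≤ Q) (n : ℕ) :
    quantError r P n ≤ quantError r Q n :=
  iInf₂_mono fun _ _ => lintegral_mono' h le_rfl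

lemma quantError_zero_measure (n : ℕ) : quantError r (0 : Measure E) n = 0 :=
  nonpos_iff_eq_zero.1 ((quantError_le_lintegral 0 (Finset.card_empty.trans_le n.zero_le)).trans_eq
    (lintegral_zero_measure _))

lemma quantError_smul {a : ℝ≥0} (ha : a ≠ 0) (P : Measure E) (n : ℕ) :
    quantError r (a • P) n = a * quantError r P n := by
  simp only [quantError, lintegral_smul_measure,
    ENNReal.mul_iInf_of_ne (ENNReal.coe_ne_zero.2 ha) ENNReal.coe_ne_top]
  rfl

lemma quantError_add_le (hr : 0 ≤ r) (P Q : Measure E) (m n : ℕ) :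
    quantError r (P + Q) (m + n) ≤ quantError r P m + quantError r Q n := by
  classical
  simp only [quantError, ENNReal.iInf_add, ENNReal.add_iInf]
  refine le_iInf₂ fun β hβ => le_iInf₂ fun α hα => ?_
  refine (quantError_le_lintegral _ ((α.card_union_le β).trans (add_le_add hα hβ))).trans ?_
  rw [lintegral_add_measure]
  gcongr
  · exact Finset.subset_union_left
  · exact Finset.subset_union_right

lemma quantError_sum_le (hr : 0 ≤ r) {ι : Type*} (s : Finset ι) (P : ι → Measure E) (n : ι → ℕ) :
    quantError r (∑ i ∈ s, P i) (∑ i ∈ s, n i) ≤ ∑ i ∈ s, quantError r (P i) (n i) := by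
  classical
  induction s using Finset.induction_on with
  | empty => simp [quantError_zero_measure]
  | insert i s hi ih =>
    simp only [Finset.sum_insert hi]
    exact (quantError_add_le hr _ _ _ _).trans (by gcongr)

lemma quantError_map_le (hr : 0 ≤ r) {c : ℝ≥0} (hc : c ≠ 0) {S : E → E} (hS : LipschitzWith c S)
    (P : Measure E) (n : ℕ) :
    quantError r (P.map S) n ≤ (c ^ r : ℝ≥0) * quantError r P n := by
  classical
  have hcr : ((c ^ r : ℝ≥0) : ℝ≥0∞) ≠ 0 := by positivity
  simp only [quantError, ENNReal.mul_iInf_of_ne hcr ENNReal.coe_ne_top]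
  refine le_iInf₂ fun α hα =>
    (quantError_le_lintegral _ (α.card_image_le.trans hα : (α.image S).card ≤ n)).trans ?_
  rw [← lintegral_const_mul' _ _ ENNReal.coe_ne_top, Finset.coe_image]
  refine (lintegral_map_le _ _).trans (lintegral_mono fun x => ?_)
  rw [ENNReal.coe_rpow_of_nonneg _ hr, ← ENNReal.mul_rpow_of_nonneg _ _ hr]
  gcongr
  exact infEDist_image_le hc hS x α

lemma tendsto_quantError_zero (hr : 0 < r) {P : Measure E} [IsProbabilityMeasure P] {K : Set E}
    (hK : TotallyBounded K) (hP : ∀ᵐ x ∂P, x ∈ K) :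
    Tendsto (quantError r P) atTop (𝓝 0) := by
  refine ENNReal.tendsto_nhds_zero.2 fun ε hε => ?_
  obtain ⟨t, ht, hKt⟩ := EMetric.totallyBounded_iff.1 hK (ε ^ r⁻¹) (by positivity)
  filter_upwards [eventually_ge_atTop ht.toFinset.card] with n hn
  calc quantError r P n ≤ ∫⁻ x, Metric.infEDist x (ht.toFinset : Set E) ^ r ∂P :=
        quantError_le_lintegral P hn
    _ ≤ ∫⁻ _, ε ∂P := by
        refine lintegral_mono_ae (hP.mono fun x hx => ?_)
        obtain ⟨y, hy, hxy⟩ := Set.mem_iUnion₂.1 (hKt hx)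
        rw [← ENNReal.le_rpow_inv_iff hr]
        exact (Metric.infEDist_le_edist_of_mem (by simpa using hy)).trans (le_of_lt hxy)
    _ = ε := by simp

lemma eventually_quantError_lt_one (hr : 0 < r) {P : Measure E} [IsProbabilityMeasure P]
    {K : Set E} (hK : TotallyBounded K) (hP : ∀ᵐ x ∂P, x ∈ K) :
    ∀ᶠ n in atTop, quantError r P n < 1 :=
  (tendsto_quantError_zero hr hK hP).eventually_lt_const zero_lt_one

lemma lowerQuantDim_mono (hr : 0 < r) {P Q : Measure E} {a : ℝ≥0} (ha : a ≠ 0) (hPQ : a • P ≤ Q)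
    (hQ : ∀ᶠ n in atTop, quantError r Q n < 1) : lowerQuantDim r P ≤ lowerQuantDim r Q := by
  refine EReal.ge_of_forall_gt_iff_ge.1 fun z hz => ?_
  rcases le_or_gt z 0 with hz0 | hz0
  · exact (EReal.coe_nonpos.2 hz0).trans (lowerQuantDim_nonneg hr hQ)
  refine coe_le_lowerQuantDim hr hQ (b := z * -Real.log a) hz0 ?_
  filter_upwards [hQ, eventually_lt_of_lt_liminf hz] with n hn hzn
  have hle : a * quantError r P n ≤ quantError r Q n :=
    (quantError_smul ha P n).symm.trans_le (quantError_mono hPQ n)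
  have hratio : z < quantRatio r P n := by exact_mod_cast hzn
  have hP0 : quantError r P n ≠ 0 := fun h0 =>
    hz0.not_gt (hratio.trans_eq (quantRatio_of_quantError_eq_zero h0))
  have hQ0 : quantError r Q n ≠ 0 :=
    ((ENNReal.mul_pos (ENNReal.coe_ne_zero.2 ha) hP0).trans_le hle).ne'
  refine ⟨hQ0, ?_⟩
  have hlogP : 0 < -Real.log (quantError r P n).toReal := by
    by_contra! hneg
    exact (hz0.trans hratio).not_ge (div_nonpos_of_nonneg_of_nonpos
      (mul_nonneg hr.le (Real.log_natCast_nonneg n)) hneg)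
  have hzlog : z * -Real.log (quantError r P n).toReal < r * Real.log n :=
    (lt_div_iff₀ hlogP).1 hratio
  have hPpos : 0 < (quantError r P n).toReal := by
    refine ENNReal.toReal_pos hP0 fun htop => ?_
    simp [htop] at hlogP
  have hle' : (a * (quantError r P n).toReal : ℝ) ≤ (quantError r Q n).toReal := by
    simpa using ENNReal.toReal_mono (hn.trans ENNReal.one_lt_top).ne hle
  have hlog := Real.log_le_log (by positivity) hle'
  rw [Real.log_mul (by positivity) hPpos.ne'] at hlog
  calc z * -Real.log (quantError r Q n).toReal
      ≤ z * -(Real.log a + Real.log (quantError r P n).toReal) := by gcongr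
    _ = z * -Real.log (quantError r P n).toReal + z * -Real.log a := by ring
    _ ≤ r * Real.log n + z * -Real.log a := by linarith

end QuantError

section SelfSimilar

lemma ae_mem_of_le_add_sum_map {X ι : Type*} [MeasurableSpace X] [Fintype ι] {m m₀ : Measure X}
    [IsFiniteMeasure m] {p : ι → ℝ≥0} {S : ι → X → X} {K : Set X} (hK : MeasurableSet K)
    (hS : ∀ i, Measurable (S i)) (hSK : ∀ i, Set.MapsTo (S i) K K) (hp : ∑ i, p i < 1)
    (hm₀ : ∀ᵐ x ∂m₀, x ∈ K) (hm : m ≤ m₀ + ∑ i, p i • m.map (S i)) : ∀ᵐ x ∂m, x ∈ K := by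
  rw [ae_iff] at hm₀ ⊢
  change m₀ Kᶜ = 0 at hm₀
  change m Kᶜ = 0
  have hmap (i : ι) : m.map (S i) Kᶜ ≤ m Kᶜ := by
    rw [Measure.map_apply (hS i) hK.compl]
    exact measure_mono fun x hx hxK => hx (hSK i hxK)
  have hle : m Kᶜ ≤ (∑ i, p i : ℝ≥0) * m Kᶜ :=
    calc m Kᶜ ≤ (m₀ + ∑ i, p i • m.map (S i)) Kᶜ := hm Kᶜ
      _ = ∑ i, p i * m.map (S i) Kᶜ := by
        simp only [Measure.add_apply, hm₀, zero_add, Measure.finsetSum_apply, Measure.smul_apply,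
          ENNReal.smul_def, smul_eq_mul]
      _ ≤ ∑ i, p i * m Kᶜ := by gcongr ∑ i, p i * ?_; exact hmap _
      _ = (∑ i, p i : ℝ≥0) * m Kᶜ := by rw [← Finset.sum_mul, ENNReal.ofNNReal_finsetSum]
  by_contra h0
  have hlt := ENNReal.mul_lt_mul_left h0 (measure_ne_top m _) (ENNReal.coe_lt_one_iff.2 hp)
  rw [one_mul] at hlt
  exact hle.not_gt hlt

lemma scaling_induction {ι : Type*} [Finite ι] {θ : ι → ℝ≥0} (hθ : ∀ i, θ i < 1)
    {P : ℝ≥0 → Prop} {x₀ : ℝ≥0} (hx₀ : 0 < x₀) (base : ∀ x ≤ x₀, P x)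
    (step : ∀ x, x₀ < x → (∀ i, P (θ i * x)) → P x) (x : ℝ≥0) : P x := by
  have := Fintype.ofFinite ι
  set A := Finset.univ.sup θ
  have hA : A < 1 := (Finset.sup_lt_iff zero_lt_one).2 fun i _ => hθ i
  have key (k : ℕ) : ∀ x, A ^ k * x ≤ x₀ → P x := by
    induction k with
    | zero => simpa using base
    | succ k ih =>
      intro x hx
      rcases le_or_gt x x₀ with hxx₀ | hxx₀
      · exact base x hxx₀
      refine step x hxx₀ fun i => ih _ ?_
      calc A ^ k * (θ i * x) ≤ A ^ k * (A * x) := by gcongr; exact Finset.le_sup (Finset.mem_univ i)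
        _ = A ^ (k + 1) * x := by ring
        _ ≤ x₀ := hx
  obtain ⟨k, hk⟩ := exists_pow_lt_of_lt_one (div_pos hx₀ (by positivity : 0 < x + 1)) hA
  refine key k x ((mul_le_mul_right le_self_add _).trans ((lt_div_iff₀ (by positivity)).1 hk).le)

lemma le_mul_rpow_mul_rpow_neg {e : ℝ} (he : 0 ≤ e) {x y : ℝ≥0} (hx : 0 < x) (hxy : x ≤ y)
    (A : ℝ≥0) : A ≤ A * y ^ e * x ^ (-e) :=
  calc A = A * x ^ e * x ^ (-e) := by
        rw [mul_assoc, ← NNReal.rpow_add hx.ne', add_neg_cancel, NNReal.rpow_zero, mul_one]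
    _ ≤ A * y ^ e * x ^ (-e) := by gcongr

lemma rpow_one_add_mul_mul_rpow_neg {e : ℝ} {θ : ℝ≥0} (hθ : 0 < θ) (B x : ℝ≥0) :
    θ ^ (1 + e) * (B * (θ * x) ^ (-e)) = B * θ * x ^ (-e) :=
  calc θ ^ (1 + e) * (B * (θ * x) ^ (-e)) = B * (θ ^ (1 + e) * θ ^ (-e)) * x ^ (-e) := by
        rw [NNReal.mul_rpow]; ring
    _ = B * θ * x ^ (-e) := by rw [← NNReal.rpow_add hθ.ne', add_neg_cancel_right, NNReal.rpow_one]

lemma add_sum_mul_rpow_neg_le {ι : Type*} [Fintype ι] {e : ℝ} {τ B₀ B : ℝ≥0} {θ : ι → ℝ≥0}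
    (hθ : ∀ i, 0 < θ i) (hsum : τ + ∑ i, θ i = 1) (hB : B₀ * τ ^ (-e) ≤ B * τ) (x : ℝ≥0) :
    B₀ * (τ * x) ^ (-e) + ∑ i, θ i ^ (1 + e) * (B * (θ i * x) ^ (-e)) ≤ B * x ^ (-e) :=
  calc B₀ * (τ * x) ^ (-e) + ∑ i, θ i ^ (1 + e) * (B * (θ i * x) ^ (-e))
      = (B₀ * τ ^ (-e) + B * ∑ i, θ i) * x ^ (-e) := by
        simp only [rpow_one_add_mul_mul_rpow_neg (hθ _)]
        rw [← Finset.sum_mul, ← Finset.mul_sum, NNReal.mul_rpow, add_mul, mul_assoc B₀]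
    _ ≤ (B * τ + B * ∑ i, θ i) * x ^ (-e) := by gcongr
    _ = B * x ^ (-e) := by rw [← mul_add, hsum, mul_one]

lemma exists_eventually_le_rpow {ι : Type*} [Fintype ι] {e : ℝ} (he : 0 ≤ e) {τ : ℝ≥0}
    {θ : ι → ℝ≥0} (hτ : 0 < τ) (hθ : ∀ i, 0 < θ i) (hsum : τ + ∑ i, θ i = 1)
    {f f₀ : ℝ≥0 → ℝ≥0∞} (hf : Antitone f) (hfin : ∃ x, f x ≠ ∞)
    (hf₀ : ∃ B : ℝ≥0, ∀ᶠ x in atTop, f₀ x ≤ (B * x ^ (-e) : ℝ≥0))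
    (hrec : ∀ x, f x ≤ f₀ (τ * x) + ∑ i, (θ i ^ (1 + e) : ℝ≥0) * f (θ i * x)) :
    ∃ B : ℝ≥0, ∀ᶠ x in atTop, f x ≤ (B * x ^ (-e) : ℝ≥0) := by
  obtain ⟨y, hy⟩ := hfin
  obtain ⟨B₀, hB₀⟩ := hf₀
  lift f y to ℝ≥0 using hy with A hA
  have htendsto {t : ℝ≥0} (ht : 0 < t) : Tendsto (t * ·) atTop atTop :=
    tendsto_id.const_mul_atTop ht
  obtain ⟨x₁, hx₁⟩ := eventually_atTop.1 (((htendsto hτ).eventually hB₀).and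
    (eventually_all.2 fun i => (htendsto (hθ i)).eventually_ge_atTop (y + 1)))
  have hθ1 (i : ι) : θ i < 1 := by
    have := Finset.single_le_sum (fun j _ => (hθ j).le) (Finset.mem_univ i)
    exact (lt_add_of_pos_of_le hτ this).trans_eq hsum
  obtain ⟨B, hAB, hBτ⟩ : ∃ B, A * (x₁ + 1) ^ e ≤ B ∧ B₀ * τ ^ (-e) ≤ B * τ := by
    refine ⟨A * (x₁ + 1) ^ e + B₀ * τ ^ (-e) / τ, le_self_add, ?_⟩
    rw [add_mul, div_mul_cancel₀ _ hτ.ne']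
    exact le_add_self
  refine ⟨B, (eventually_ge_atTop (y + 1)).mono fun x => ?_⟩
  refine scaling_induction hθ1 (P := fun x => y + 1 ≤ x → f x ≤ (B * x ^ (-e) : ℝ≥0))
    (x₀ := x₁ + 1) (by positivity) (fun x hx hyx => ?_) (fun x hx ih _ => ?_) x
  · have hx0 : 0 < x := (by positivity : 0 < y + 1).trans_le hyx
    have hfx : f x ≤ A := hA ▸ hf (le_self_add.trans hyx)
    refine hfx.trans (ENNReal.coe_le_coe.2 ?_)
    exact (le_mul_rpow_mul_rpow_neg he hx0 hx A).trans (by gcongr)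
  · obtain ⟨hx₀, hxθ⟩ := hx₁ x (le_self_add.trans hx.le)
    calc f x ≤ f₀ (τ * x) + ∑ i, (θ i ^ (1 + e) : ℝ≥0) * f (θ i * x) := hrec x
      _ ≤ (B₀ * (τ * x) ^ (-e) + ∑ i, θ i ^ (1 + e) * (B * (θ i * x) ^ (-e)) : ℝ≥0) := by
          rw [ENNReal.coe_add, ENNReal.ofNNReal_finsetSum]
          simp only [ENNReal.coe_mul (θ _ ^ (1 + e))]
          gcongr with i
          exact ih i (hxθ i)
      _ ≤ (B * x ^ (-e) : ℝ≥0) := ENNReal.coe_le_coe.2 (add_sum_mul_rpow_neg_le hθ hsum hBτ x)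

end SelfSimilar

section UpperBound

variable {E : Type*} [NormedAddCommGroup E] [MeasurableSpace E] {r e : ℝ} {m m₀ : Measure E}

/-- The `n`th quantization error of order `r` of `m` is `O(n ^ (-e))`. For `e = r / D` this says
that the `D`-dimensional upper quantization coefficient of `m` is finite. Real arguments `x` in
place of `n` make the estimate stable under rescaling `x` by the factors of a similarity. -/
def HasQuantErrorDecay (r e : ℝ) (m : Measure E) : Prop :=
  ∃ B : ℝ≥0, ∀ᶠ x : ℝ≥0 in atTop, quantError r m ⌊x⌋₊ ≤ (B * x ^ (-e) : ℝ≥0)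

lemma hasQuantErrorDecay_zero : HasQuantErrorDecay r e (0 : Measure E) :=
  ⟨0, .of_forall fun _ => by simp [quantError_zero_measure]⟩

lemma HasQuantErrorDecay.smul (hm : HasQuantErrorDecay r e m) {a : ℝ≥0} (ha : a ≠ 0) :
    HasQuantErrorDecay r e (a • m) := by
  obtain ⟨B, hB⟩ := hm
  refine ⟨a * B, hB.mono fun x hx => ?_⟩
  rw [quantError_smul ha, mul_assoc, ENNReal.coe_mul]
  gcongr

lemma HasQuantErrorDecay.upperQuantDim_le (hr : 0 < r) {D : ℝ} (hD : 0 < D)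
    (hm : HasQuantErrorDecay r (r / D) m) (h1 : ∀ᶠ n in atTop, quantError r m n < 1) :
    upperQuantDim r m ≤ D := by
  obtain ⟨B, hB⟩ := hm
  refine upperQuantDim_le_coe_of_le_rpow hr h1 hD (B := B + 1) (by positivity) ?_
  filter_upwards [tendsto_natCast_atTop_atTop.eventually hB] with n hn
  rw [Nat.floor_natCast] at hn
  refine hn.trans ?_
  gcongr
  exact le_self_add

variable {ι : Type*} [Fintype ι] {S : ι → E → E} {p c : ι → ℝ≥0}

lemma quantError_le_add_sum (hr : 0 ≤ r) (hp : ∀ i, p i ≠ 0) (hc : ∀ i, c i ≠ 0)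
    (hS : ∀ i, LipschitzWith (c i) (S i)) (hm : m ≤ m₀ + ∑ i, p i • m.map (S i)) {n n₀ : ℕ}
    {k : ι → ℕ} (hn : n₀ + ∑ i, k i ≤ n) :
    quantError r m n ≤
      quantError r m₀ n₀ + ∑ i, (p i * c i ^ r : ℝ≥0) * quantError r m (k i) :=
  calc quantError r m n ≤ quantError r m (n₀ + ∑ i, k i) := quantError_antitone m hn
    _ ≤ quantError r (m₀ + ∑ i, p i • m.map (S i)) (n₀ + ∑ i, k i) := quantError_mono hm _
    _ ≤ quantError r m₀ n₀ + ∑ i, quantError r (p i • m.map (S i)) (k i) :=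
      (quantError_add_le hr _ _ _ _).trans (by gcongr; exact quantError_sum_le hr _ _ _)
    _ ≤ quantError r m₀ n₀ + ∑ i, (p i * c i ^ r : ℝ≥0) * quantError r m (k i) := by
      gcongr with i
      rw [quantError_smul (hp i), ENNReal.coe_mul, mul_assoc]
      gcongr
      exact quantError_map_le hr (hc i) (hS i) m (k i)

lemma floor_mul_add_sum_floor_mul_le {τ : ℝ≥0} {θ : ι → ℝ≥0} (h : τ + ∑ i, θ i ≤ 1) (x : ℝ≥0) :
    ⌊τ * x⌋₊ + ∑ i, ⌊θ i * x⌋₊ ≤ ⌊x⌋₊ := by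
  refine Nat.le_floor ?_
  push_cast
  calc (⌊τ * x⌋₊ : ℝ≥0) + ∑ i, (⌊θ i * x⌋₊ : ℝ≥0) ≤ τ * x + ∑ i, θ i * x := by
        gcongr <;> exact Nat.floor_le zero_le
    _ = (τ + ∑ i, θ i) * x := by rw [add_mul, Finset.sum_mul]
    _ ≤ x := mul_le_of_le_one_left zero_le h

lemma HasQuantErrorDecay.of_le_add_sum (hr : 0 ≤ r) (he : 0 < e) (hp : ∀ i, p i ≠ 0)
    (hc : ∀ i, c i ≠ 0) (hS : ∀ i, LipschitzWith (c i) (S i))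
    (hsum : ∑ i, (p i * c i ^ r) ^ (1 + e)⁻¹ < 1) (hm : m ≤ m₀ + ∑ i, p i • m.map (S i))
    (hfin : ∃ n, quantError r m n ≠ ∞) (hm₀ : HasQuantErrorDecay r e m₀) :
    HasQuantErrorDecay r e m := by
  have hτ := tsub_add_cancel_of_le hsum.le
  have hθ (i : ι) : 0 < (p i * c i ^ r) ^ (1 + e)⁻¹ :=
    NNReal.rpow_pos (pos_iff_ne_zero.2 (mul_ne_zero (hp i) (by simp [hc i])))
  obtain ⟨n, hn⟩ := hfin
  refine exists_eventually_le_rpow he.le (tsub_pos_of_lt hsum) hθ hτ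
    (fun _ _ h => quantError_antitone m (Nat.floor_mono h)) ⟨n, by simpa using hn⟩ hm₀ fun x => ?_
  simp only [NNReal.rpow_inv_rpow (by positivity : 1 + e ≠ 0)]
  exact quantError_le_add_sum hr hp hc hS hm (floor_mul_add_sum_floor_mul_le hτ.le x)

end UpperBound

section LowerBound

section Recursion

variable {ι Φ : Type*} [Fintype ι] {e : ℝ} {θ : ι → ℝ≥0} {I : Φ → ℝ≥0∞} {c : Φ → ℕ} {H : ℝ≥0}

lemma coe_mul_rpow_neg_le_add {θ κ x : ℝ≥0} (hθ : 0 < θ) {J : ℝ≥0∞} {n : ℕ}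
    (h : ((κ * (θ * x) ^ (-e) : ℝ≥0) : ℝ≥0∞) ≤ J + (κ * (θ * x) ^ (-(1 + e)) * n : ℝ≥0)) :
    ((κ * θ * x ^ (-e) : ℝ≥0) : ℝ≥0∞) ≤
      (θ ^ (1 + e) : ℝ≥0) * J + (κ * x ^ (-(1 + e)) * n : ℝ≥0) := by
  have hcancel : θ ^ (1 + e) * (κ * (θ * x) ^ (-(1 + e)) * n) = κ * x ^ (-(1 + e)) * n :=
    calc θ ^ (1 + e) * (κ * (θ * x) ^ (-(1 + e)) * n)
        = κ * (θ ^ (1 + e) * θ ^ (-(1 + e))) * x ^ (-(1 + e)) * n := by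
          rw [NNReal.mul_rpow]; ring
      _ = κ * x ^ (-(1 + e)) * n := by
          rw [← NNReal.rpow_add hθ.ne', add_neg_cancel, NNReal.rpow_zero, mul_one]
  calc ((κ * θ * x ^ (-e) : ℝ≥0) : ℝ≥0∞)
      = (θ ^ (1 + e) : ℝ≥0) * (κ * (θ * x) ^ (-e) : ℝ≥0) := by
        rw [← rpow_one_add_mul_mul_rpow_neg hθ, ENNReal.coe_mul]
    _ ≤ (θ ^ (1 + e) : ℝ≥0) * (J + (κ * (θ * x) ^ (-(1 + e)) * n : ℝ≥0)) := by gcongr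
    _ = (θ ^ (1 + e) : ℝ≥0) * J + (κ * x ^ (-(1 + e)) * n : ℝ≥0) := by
        rw [mul_add, ← ENNReal.coe_mul, hcancel]

lemma exists_rpow_le_add (he : 0 ≤ e) (hθ0 : ∀ i, 0 < θ i) (hθ1 : ∀ i, θ i < 1)
    (hsum : ∑ i, θ i = 1) (hH : 0 < H) (hI : ∀ F, c F = 0 → H ≤ I F)
    (hrec : ∀ F, ∃ G : ι → Φ, ∑ i, c (G i) ≤ c F ∧
      ∑ i, (θ i ^ (1 + e) : ℝ≥0) * I (G i) ≤ I F) :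
    ∃ κ : ℝ≥0, 0 < κ ∧ ∀ x : ℝ≥0, 1 ≤ x → ∀ F,
      ((κ * x ^ (-e) : ℝ≥0) : ℝ≥0∞) ≤ I F + (κ * x ^ (-(1 + e)) * c F : ℝ≥0) := by
  rcases isEmpty_or_nonempty ι with hι | hι
  · simp at hsum
  obtain ⟨j, hj⟩ := Finite.exists_min θ
  obtain ⟨κ, hκ, hκH⟩ : ∃ κ, 0 < κ ∧ κ * θ j ^ (-e) ≤ H := by
    have := hθ0 j
    refine ⟨H * θ j ^ e, by positivity, ?_⟩
    rw [mul_assoc, ← NNReal.rpow_add this.ne', add_neg_cancel, NNReal.rpow_zero, mul_one]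
  refine ⟨κ, hκ, fun x hx => ?_⟩
  refine scaling_induction hθ1 (P := fun x => θ j ≤ x → ∀ F,
    ((κ * x ^ (-e) : ℝ≥0) : ℝ≥0∞) ≤ I F + (κ * x ^ (-(1 + e)) * c F : ℝ≥0))
    zero_lt_one (fun x hx hjx F => ?_) (fun x hx ih _ F => ?_) x ((hθ1 j).le.trans hx)
  · rcases (c F).eq_zero_or_pos with h0 | hpos
    · refine le_add_right (le_trans (ENNReal.coe_le_coe.2 ?_) (hI F h0))
      refine le_trans ?_ hκH
      gcongr κ * ?_
      exact NNReal.rpow_le_rpow_of_nonpos (hθ0 j) hjx (by linarith)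
    · refine le_add_left (ENNReal.coe_le_coe.2 ?_)
      calc κ * x ^ (-e) ≤ κ * x ^ (-(1 + e)) := by
            gcongr κ * ?_
            exact NNReal.rpow_le_rpow_of_exponent_ge ((hθ0 j).trans_le hjx) hx (by linarith)
        _ ≤ κ * x ^ (-(1 + e)) * c F :=
            le_mul_of_one_le_right zero_le (by exact_mod_cast hpos)
  · obtain ⟨G, hcard, hint⟩ := hrec F
    have hjθ (i : ι) : θ j ≤ θ i * x := (hj i).trans (le_mul_of_one_le_right zero_le hx.le)
    calc ((κ * x ^ (-e) : ℝ≥0) : ℝ≥0∞) = ∑ i, ((κ * θ i * x ^ (-e) : ℝ≥0) : ℝ≥0∞) := by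
          rw [← ENNReal.ofNNReal_finsetSum, ← Finset.sum_mul, ← Finset.mul_sum, hsum, mul_one]
      _ ≤ ∑ i, ((θ i ^ (1 + e) : ℝ≥0) * I (G i) + (κ * x ^ (-(1 + e)) * c (G i) : ℝ≥0)) :=
          Finset.sum_le_sum fun i _ => coe_mul_rpow_neg_le_add (hθ0 i) (ih i (hjθ i) (G i))
      _ = ∑ i, (θ i ^ (1 + e) : ℝ≥0) * I (G i) +
            (κ * x ^ (-(1 + e)) * (∑ i, c (G i) : ℕ) : ℝ≥0) := by
          rw [Finset.sum_add_distrib, ← ENNReal.ofNNReal_finsetSum, ← Finset.mul_sum, Nat.cast_sum]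
      _ ≤ I F + (κ * x ^ (-(1 + e)) * c F : ℝ≥0) := by gcongr

lemma exists_rpow_le (he : 0 ≤ e) (hθ0 : ∀ i, 0 < θ i) (hθ1 : ∀ i, θ i < 1)
    (hsum : ∑ i, θ i = 1) (hH : 0 < H) (hI : ∀ F, c F = 0 → H ≤ I F)
    (hrec : ∀ F, ∃ G : ι → Φ, ∑ i, c (G i) ≤ c F ∧
      ∑ i, (θ i ^ (1 + e) : ℝ≥0) * I (G i) ≤ I F) :
    ∃ κ : ℝ≥0, 0 < κ ∧ ∀ n : ℕ, 0 < n → ∀ F, c F ≤ n →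
      ((κ * n ^ (-e) : ℝ≥0) : ℝ≥0∞) ≤ I F := by
  obtain ⟨κ, hκ, h⟩ := exists_rpow_le_add he hθ0 hθ1 hsum hH hI hrec
  refine ⟨κ * 2 ^ (-e) / 2, by positivity, fun n hn F hF => ?_⟩
  have hx : (1 : ℝ≥0) ≤ 2 * n := by exact_mod_cast (by lia : 1 ≤ 2 * n)
  have hx0 : (2 * n : ℝ≥0) ≠ 0 := by positivity
  have hhalf : κ * (2 * n : ℝ≥0) ^ (-(1 + e)) * n = κ * 2 ^ (-e) / 2 * n ^ (-e) := by
    rw [neg_add, NNReal.rpow_add hx0, NNReal.rpow_neg_one, NNReal.mul_rpow]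
    field_simp
  refine (ENNReal.add_le_add_iff_right (ENNReal.coe_ne_top (r := κ * 2 ^ (-e) / 2 * n ^ (-e)))).1 ?_
  calc ((κ * 2 ^ (-e) / 2 * n ^ (-e) : ℝ≥0) : ℝ≥0∞) + (κ * 2 ^ (-e) / 2 * n ^ (-e) : ℝ≥0)
      = (κ * (2 * n) ^ (-e) : ℝ≥0) := by
        rw [← ENNReal.coe_add, ← add_mul, add_halves, NNReal.mul_rpow, mul_assoc]
    _ ≤ I F + (κ * (2 * n) ^ (-(1 + e)) * c F : ℝ≥0) := h _ hx F
    _ ≤ I F + (κ * (2 * n) ^ (-(1 + e)) * n : ℝ≥0) := by gcongr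
    _ = I F + (κ * 2 ^ (-e) / 2 * n ^ (-e) : ℝ≥0) := by rw [hhalf]

end Recursion

section VirtualCenter

variable {X : Type*}

/-- `f` behaves like the distance to a point which need not lie in `X`. Unlike actual points, such
virtual centers can be pulled back along expanding maps that are not surjective. -/
structure IsVirtualCenter [PseudoEMetricSpace X] [MeasurableSpace X] (f : X → ℝ≥0∞) : Prop where
  measurable : Measurable f
  edist_le_add : ∀ x y, edist x y ≤ f x + f y

/-- The distance to a finite set `F` of virtual centers, truncated at height `h`. -/
noncomputable def truncatedDist (h : ℝ≥0∞) (F : Finset (X → ℝ≥0∞)) (x : X) : ℝ≥0∞ :=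
  min h (⨅ f ∈ F, f x)

open Classical in
/-- The members of `F` that come within distance `h` of the set `A`. -/
noncomputable def centersNear (h : ℝ≥0∞) (A : Set X) (F : Finset (X → ℝ≥0∞)) : Finset (X → ℝ≥0∞) :=
  F.filter fun f => ∃ y ∈ A, f y < h

open Classical in
/-- The virtual centers that `F` induces on `K` through the piece `S '' K`: those near `S '' K`,
composed with `S` and rescaled by `s⁻¹`, where `s` is a lower bound for the contraction of `S`. -/
noncomputable def pullbackCenters (h : ℝ≥0∞) (s : ℝ≥0) (S : X → X) (K : Set X)
    (F : Finset (X → ℝ≥0∞)) : Finset (X → ℝ≥0∞) :=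
  (centersNear h (S '' K) F).image fun f x => (s⁻¹ : ℝ≥0) * f (S x)

lemma mul_truncatedDist_pullbackCenters_le {h : ℝ≥0∞} {s : ℝ≥0} {S : X → X} {K : Set X}
    {F : Finset (X → ℝ≥0∞)} (hs0 : s ≠ 0) (hs1 : s ≤ 1) {x : X} (hx : x ∈ K) :
    s * truncatedDist h (pullbackCenters h s S K F) x ≤ truncatedDist h F (S x) := by
  classical
  have hle_h : s * truncatedDist h (pullbackCenters h s S K F) x ≤ h :=
    (mul_le_of_le_one_left' (by exact_mod_cast hs1)).trans (min_le_left _ _)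
  refine le_min hle_h (le_iInf₂ fun f hf => ?_)
  rcases le_or_gt h (f (S x)) with hfx | hfx
  · exact hle_h.trans hfx
  have hmem : f ∈ centersNear h (S '' K) F :=
    Finset.mem_filter.2 ⟨hf, S x, Set.mem_image_of_mem S hx, hfx⟩
  calc s * truncatedDist h (pullbackCenters h s S K F) x ≤ s * ((s⁻¹ : ℝ≥0) * f (S x)) := by
        gcongr
        exact (min_le_right _ _).trans (iInf₂_le _ (Finset.mem_image_of_mem _ hmem))
    _ = f (S x) := by
        rw [← mul_assoc, ← ENNReal.coe_mul, mul_inv_cancel₀ hs0, ENNReal.coe_one, one_mul]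

variable [PseudoEMetricSpace X] [MeasurableSpace X]

lemma isVirtualCenter_edist [OpensMeasurableSpace X] (a : X) : IsVirtualCenter (edist · a) :=
  ⟨(continuous_id.edist continuous_const).measurable, fun x y => edist_triangle_right x y a⟩

lemma IsVirtualCenter.comp {f : X → ℝ≥0∞} (hf : IsVirtualCenter f) {c : ℝ≥0} {S : X → X}
    (hS : Measurable S) (hSc : AntilipschitzWith c S) : IsVirtualCenter fun x => c * f (S x) :=
  ⟨(hf.measurable.comp hS).const_mul _, fun x y =>
    (hSc x y).trans ((mul_le_mul_right (hf.edist_le_add _ _) _).trans_eq (mul_add _ _ _))⟩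

lemma isVirtualCenter_of_mem_pullbackCenters {h : ℝ≥0∞} {s : ℝ≥0} {S : X → X} {K : Set X}
    {F : Finset (X → ℝ≥0∞)} (hS : Measurable S) (hSs : AntilipschitzWith s⁻¹ S)
    (hF : ∀ f ∈ F, IsVirtualCenter f) : ∀ f ∈ pullbackCenters h s S K F, IsVirtualCenter f := by
  classical
  intro f hf
  obtain ⟨f, hfF, rfl⟩ := Finset.mem_image.1 hf
  exact (hF f (Finset.mem_filter.1 hfF).1).comp hS hSs

lemma measurable_truncatedDist {h : ℝ≥0∞} {F : Finset (X → ℝ≥0∞)}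
    (hF : ∀ f ∈ F, IsVirtualCenter f) : Measurable (truncatedDist h F) :=
  measurable_const.min (Measurable.biInf _ F.countable_toSet fun f hf => (hF f hf).measurable)

lemma sum_card_centersNear_le {ι : Type*} [Fintype ι] {h : ℝ≥0∞} {A : ι → Set X}
    (hA : ∀ i j, i ≠ j → ∀ y ∈ A i, ∀ z ∈ A j, h + h ≤ edist y z) {F : Finset (X → ℝ≥0∞)}
    (hF : ∀ f ∈ F, IsVirtualCenter f) : ∑ i, (centersNear h (A i) F).card ≤ F.card := by
  classical
  rw [← Finset.card_biUnion]
  · exact Finset.card_le_card (Finset.biUnion_subset.2 fun i _ => Finset.filter_subset _ _)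
  intro i _ j _ hij
  refine Finset.disjoint_left.2 fun f hfi hfj => ?_
  obtain ⟨hfF, y, hy, hfy⟩ := Finset.mem_filter.1 hfi
  obtain ⟨-, z, hz, hfz⟩ := Finset.mem_filter.1 hfj
  exact ((hA i j hij y hy z hz).trans ((hF f hfF).edist_le_add y z)).not_gt
    (ENNReal.add_lt_add hfy hfz)

variable {ι : Type*} [Fintype ι] {r : ℝ} {h : ℝ≥0∞} {s p : ι → ℝ≥0} {S : ι → X → X} {K : Set X}
  {μ : Measure X}

lemma sum_mul_lintegral_pullbackCenters_le (hr : 0 ≤ r) (hs0 : ∀ i, s i ≠ 0) (hs1 : ∀ i, s i ≤ 1)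
    (hS : ∀ i, Measurable (S i)) (hK : ∀ᵐ x ∂μ, x ∈ K) (hμ : ∑ i, p i • μ.map (S i) ≤ μ)
    {F : Finset (X → ℝ≥0∞)} (hF : ∀ f ∈ F, IsVirtualCenter f) :
    ∑ i, (p i * s i ^ r : ℝ≥0) *
        ∫⁻ x, truncatedDist h (pullbackCenters h (s i) (S i) K F) x ^ r ∂μ ≤
      ∫⁻ x, truncatedDist h F x ^ r ∂μ := by
  have hpiece (i : ι) : (s i ^ r : ℝ≥0) *
        ∫⁻ x, truncatedDist h (pullbackCenters h (s i) (S i) K F) x ^ r ∂μ ≤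
      ∫⁻ x, truncatedDist h F x ^ r ∂μ.map (S i) := by
    rw [lintegral_map ((measurable_truncatedDist hF).pow_const r) (hS i),
      ← lintegral_const_mul' _ _ ENNReal.coe_ne_top]
    refine lintegral_mono_ae (hK.mono fun x hx => ?_)
    rw [ENNReal.coe_rpow_of_nonneg _ hr, ← ENNReal.mul_rpow_of_nonneg _ _ hr]
    gcongr
    exact mul_truncatedDist_pullbackCenters_le (hs0 i) (hs1 i) hx
  calc _ ≤ ∑ i, p i * ∫⁻ x, truncatedDist h F x ^ r ∂μ.map (S i) := by
        simp only [ENNReal.coe_mul (p _), mul_assoc]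
        gcongr with i
        exact hpiece i
    _ = ∫⁻ x, truncatedDist h F x ^ r ∂(∑ i, p i • μ.map (S i)) := by
        simp only [lintegral_finsetSum_measure, lintegral_smul_measure, ENNReal.smul_def,
          smul_eq_mul]
    _ ≤ ∫⁻ x, truncatedDist h F x ^ r ∂μ := lintegral_mono' hμ le_rfl

lemma exists_rpow_le_lintegral_truncatedDist [IsProbabilityMeasure μ] {e : ℝ} (hr : 0 ≤ r)
    (he : 0 ≤ e) (hs0 : ∀ i, s i ≠ 0) (hs1 : ∀ i, s i ≤ 1) (hp : ∀ i, p i ≠ 0)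
    (hps : ∀ i, p i * s i ^ r < 1) (hsum : ∑ i, (p i * s i ^ r) ^ (1 + e)⁻¹ = 1)
    (hS : ∀ i, Measurable (S i)) (hSs : ∀ i, AntilipschitzWith (s i)⁻¹ (S i)) {h : ℝ≥0}
    (hh : 0 < h) (hsep : ∀ i j, i ≠ j → ∀ y ∈ S i '' K, ∀ z ∈ S j '' K, (h + h : ℝ≥0∞) ≤ edist y z)
    (hK : ∀ᵐ x ∂μ, x ∈ K) (hμ : ∑ i, p i • μ.map (S i) ≤ μ) :
    ∃ κ : ℝ≥0, 0 < κ ∧ ∀ n : ℕ, 0 < n → ∀ F : Finset (X → ℝ≥0∞), (∀ f ∈ F, IsVirtualCenter f) →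
      F.card ≤ n →
      ((κ * n ^ (-e) : ℝ≥0) : ℝ≥0∞) ≤ ∫⁻ x, truncatedDist h F x ^ r ∂μ := by
  classical
  have hb (i : ι) : 0 < p i * s i ^ r :=
    pos_iff_ne_zero.2 (mul_ne_zero (hp i) (by simp [hs0 i]))
  have he' : 0 < 1 + e := by positivity
  have hempty (F : Finset (X → ℝ≥0∞)) (hF : F.card = 0) :
      ((h ^ r : ℝ≥0) : ℝ≥0∞) ≤ ∫⁻ x, truncatedDist h F x ^ r ∂μ := by
    simp [Finset.card_eq_zero.1 hF, truncatedDist, ENNReal.coe_rpow_of_nonneg _ hr]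
  obtain ⟨κ, hκ, h⟩ := exists_rpow_le
    (Φ := {F : Finset (X → ℝ≥0∞) // ∀ f ∈ F, IsVirtualCenter f}) (c := fun F => F.1.card)
    (I := fun F => ∫⁻ x, truncatedDist h F.1 x ^ r ∂μ) (H := h ^ r) he
    (fun i => NNReal.rpow_pos (hb i)) (fun i => NNReal.rpow_lt_one (hps i) (inv_pos.2 he')) hsum
    (by positivity)
    (fun F => hempty F.1)
    fun F => ⟨fun i =>
        ⟨_, isVirtualCenter_of_mem_pullbackCenters (K := K) (h := h) (hS i) (hSs i) F.2⟩,
      (Finset.sum_le_sum fun i _ => Finset.card_image_le).trans (sum_card_centersNear_le hsep F.2),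
      by simpa only [NNReal.rpow_inv_rpow he'.ne'] using
        sum_mul_lintegral_pullbackCenters_le hr hs0 hs1 hS hK hμ F.2⟩
  exact ⟨κ, hκ, fun n hn F hF hFn => h n hn ⟨F, hF⟩ hFn⟩

end VirtualCenter

lemma exists_pos_forall_add_self_le_edist {X ι : Type*} [EMetricSpace X] [Finite ι]
    {A : ι → Set X} (hA : ∀ i, IsCompact (A i)) (hdisj : ∀ i j, i ≠ j → Disjoint (A i) (A j)) :
    ∃ h : ℝ≥0, 0 < h ∧
      ∀ i j, i ≠ j → ∀ y ∈ A i, ∀ z ∈ A j, (h + h : ℝ≥0∞) ≤ edist y z := by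
  have hsep : ∀ᶠ h : ℝ≥0 in 𝓝[>] 0, ∀ i j, i ≠ j → ∀ y ∈ A i, ∀ z ∈ A j,
      (h + h : ℝ≥0∞) ≤ edist y z := by
    refine eventually_all.2 fun i => eventually_all.2 fun j => ?_
    rcases eq_or_ne i j with hij | hij
    · exact .of_forall fun _ hne => absurd hij hne
    obtain ⟨ε, hε, hlt⟩ := Metric.exists_pos_forall_lt_edist (hA i) (hA j).isClosed (hdisj i j hij)
    filter_upwards [Ioc_mem_nhdsGT (half_pos hε)] with h hh _ y hy z hz
    refine le_trans ?_ (hlt y hy z hz).le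
    exact_mod_cast (add_le_add hh.2 hh.2).trans_eq (add_halves ε)
  obtain ⟨h, hle, hpos⟩ := (hsep.and self_mem_nhdsWithin).exists
  exact ⟨h, hpos, hle⟩

variable {E : Type*} [NormedAddCommGroup E] [MeasurableSpace E] {r : ℝ} {μ : Measure E}

lemma le_quantError_of_le_lintegral_truncatedDist [OpensMeasurableSpace E] (hr : 0 ≤ r)
    {h b : ℝ≥0∞} {n : ℕ}
    (hb : ∀ F : Finset (E → ℝ≥0∞), (∀ f ∈ F, IsVirtualCenter f) → F.card ≤ n →
      b ≤ ∫⁻ x, truncatedDist h F x ^ r ∂μ) : b ≤ quantError r μ n := by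
  classical
  refine le_iInf₂ fun α hα => ?_
  let F : Finset (E → ℝ≥0∞) := α.image fun a x => edist x a
  have hF : ∀ f ∈ F, IsVirtualCenter f := fun f hf => by
    obtain ⟨a, -, rfl⟩ := Finset.mem_image.1 hf
    exact isVirtualCenter_edist a
  refine (hb F hF (Finset.card_image_le.trans hα)).trans (lintegral_mono fun x => ?_)
  gcongr
  exact (min_le_right _ _).trans (le_iInf₂ fun a ha => iInf₂_le _ (Finset.mem_image_of_mem _ ha))

variable [BorelSpace E] [IsProbabilityMeasure μ] {ι : Type*} [Fintype ι] {S : ι → E → E}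
  {s p : ι → ℝ≥0} {K : Set E}

lemma coe_le_lowerQuantDim_of_sum_smul_map_le {k : ℝ} (hr : 0 < r) (hk : 0 < k)
    (hs0 : ∀ i, s i ≠ 0) (hs1 : ∀ i, s i ≤ 1) (hp : ∀ i, p i ≠ 0) (hps : ∀ i, p i * s i ^ r < 1)
    (hsum : ∑ i, (p i * s i ^ r) ^ (1 + r / k)⁻¹ = 1) (hS : ∀ i, Continuous (S i))
    (hSs : ∀ i, AntilipschitzWith (s i)⁻¹ (S i)) (hKc : IsCompact K)
    (hdisj : ∀ i j, i ≠ j → Disjoint (S i '' K) (S j '' K)) (hK : ∀ᵐ x ∂μ, x ∈ K)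
    (hμ : ∑ i, p i • μ.map (S i) ≤ μ) : (k : EReal) ≤ lowerQuantDim r μ := by
  obtain ⟨h, hh, hsep⟩ := exists_pos_forall_add_self_le_edist (fun i => hKc.image (hS i)) hdisj
  obtain ⟨κ, hκ, hle⟩ := exists_rpow_le_lintegral_truncatedDist hr.le (div_nonneg hr.le hk.le) hs0
    hs1 hp hps hsum (fun i => (hS i).measurable) hSs hh hsep hK hμ
  refine coe_le_lowerQuantDim_of_rpow_le hr
    (eventually_quantError_lt_one hr hKc.totallyBounded hK) hk hκ ?_
  filter_upwards [eventually_gt_atTop 0] with n hn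
  exact le_quantError_of_le_lintegral_truncatedDist hr.le (hle n hn)

end LowerBound

section Condensation

lemma IsProbVector.sum_succ_lt_one {N : ℕ} {p : Fin (N + 1) → ℝ} (hp : IsProbVector p) :
    ∑ i : Fin N, p i.succ < 1 := by
  have := hp.2
  rw [Fin.sum_univ_succ] at this
  linarith [hp.1 0]

lemma IsProbVector.one_le_card {M : ℕ} {t : Fin M → ℝ} (ht : IsProbVector t) : 1 ≤ M := by
  rcases Nat.eq_zero_or_pos M with rfl | hM
  · simpa using ht.2
  · exact hM

lemma div_add_eq_inv_one_add_div {r k : ℝ} (hk : k ≠ 0) : k / (r + k) = (1 + r / k)⁻¹ := by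
  rw [one_add_div hk, inv_div, add_comm]

variable {E : Type*} [NormedAddCommGroup E] {r : ℝ} {N : ℕ} {S : Fin N → E → E}
  {p : Fin (N + 1) → ℝ} {C K : Set E}

lemma IsCondensationAttractor.mapsTo (hK : IsCondensationAttractor S C K) (i : Fin N) :
    Set.MapsTo (S i) K K := fun x hx => by
  rw [hK.2]
  exact .inl (Set.mem_iUnion_of_mem i (Set.mem_image_of_mem _ hx))

variable [MeasurableSpace E] {ν μ : Measure E} [IsProbabilityMeasure μ]

lemma IsCondensationMeasure.lowerQuantDim_le (hμ : IsCondensationMeasure S p ν μ) (hr : 0 < r)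
    (hp : IsProbVector p) (hK : IsCompact K) (hμK : ∀ᵐ x ∂μ, x ∈ K) :
    lowerQuantDim r ν ≤ lowerQuantDim r μ := by
  have hp0 : (p 0).toNNReal ≠ 0 := (Real.toNNReal_pos.2 (hp.1 0)).ne'
  refine lowerQuantDim_mono hr hp0 ?_ (eventually_quantError_lt_one hr hK.totallyBounded hμK)
  exact (Measure.le_add_right le_rfl).trans_eq hμ.symm

lemma HasQuantErrorDecay.of_isDimSolution (hr : 0 < r) (hN : 1 ≤ N) {q c : Fin N → ℝ}
    (hq : ∀ i, 0 < q i) (hq1 : ∑ i, q i ≤ 1) (hc : ∀ i, 0 < c i) (hc1 : ∀ i, c i < 1)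
    (hS : ∀ i x y, dist (S i x) (S i y) ≤ c i * dist x y) {l D : ℝ}
    (hl : IsDimSolution r q c l) (hlD : l < D) (hK : IsCompact K) (hμK : ∀ᵐ x ∂μ, x ∈ K)
    (hν : HasQuantErrorDecay r (r / D) ν)
    (hμ : μ ≤ ν + ∑ i, ENNReal.ofReal (q i) • μ.map (S i)) : HasQuantErrorDecay r (r / D) μ := by
  have hD : 0 < D := hl.1.trans_lt hlD
  have hsum := hl.sum_rpow_lt_one hr hN hq hq1 hc hc1 hlD
  rw [div_add_eq_inv_one_add_div hD.ne'] at hsum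
  lift q to Fin N → ℝ≥0 using fun i => (hq i).le
  lift c to Fin N → ℝ≥0 using fun i => (hc i).le
  beta_reduce at hsum
  simp only [ENNReal.ofReal_coe_nnreal] at hμ
  obtain ⟨n, hn⟩ := (eventually_quantError_lt_one hr hK.totallyBounded hμK).exists
  exact .of_le_add_sum hr.le (div_pos hr hD) (fun i => (mod_cast hq i : 0 < q i).ne')
    (fun i => (mod_cast hc i : 0 < c i).ne') (fun i => .of_dist_le_mul (hS i)) (mod_cast hsum) hμ
    ⟨n, (hn.trans ENNReal.one_lt_top).ne⟩ hν

lemma IsCondensationMeasure.upperQuantDim_le [IsProbabilityMeasure ν]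
    (hμ : IsCondensationMeasure S p ν μ) (hr : 0 < r) (hN : 1 ≤ N) (hp : IsProbVector p)
    {c : Fin N → ℝ} (hc : ∀ i, 0 < c i) (hc1 : ∀ i, c i < 1)
    (hS : ∀ i x y, dist (S i x) (S i y) ≤ c i * dist x y) (hK : IsCompact K)
    (hνK : ∀ᵐ x ∂ν, x ∈ K) (hμK : ∀ᵐ x ∂μ, x ∈ K) {M : ℕ} {g : Fin M → E → E} {ρ t : Fin M → ℝ}
    (hρ : ∀ j, 0 < ρ j) (hρ1 : ∀ j, ρ j < 1) (hg : ∀ j x y, dist (g j x) (g j y) ≤ ρ j * dist x y)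
    (ht : IsProbVector t) (hν : IsInvariantMeasure g t ν) {l d : ℝ}
    (hl : IsDimSolution r (fun i => p i.succ) c l) (hd : IsDimSolution r t ρ d) :
    upperQuantDim r μ ≤ max (l : EReal) (d : EReal) := by
  refine EReal.le_of_forall_lt_iff_le.1 fun D hD => ?_
  have hlD : l < D := mod_cast (max_lt_iff.1 hD).1
  have hdD : d < D := mod_cast (max_lt_iff.1 hD).2
  have hν_decay : HasQuantErrorDecay r (r / D) ν :=
    .of_isDimSolution hr ht.one_le_card ht.1 ht.2.le hρ hρ1 hg hd hdD hK hνK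
      hasQuantErrorDecay_zero (hν.le.trans_eq (zero_add _).symm)
  have hμ_decay : HasQuantErrorDecay r (r / D) μ :=
    .of_isDimSolution hr hN (fun i => hp.1 i.succ) hp.sum_succ_lt_one.le hc hc1 hS hl hlD hK hμK
      (hν_decay.smul (Real.toNNReal_pos.2 (hp.1 0)).ne') hμ.le
  exact hμ_decay.upperQuantDim_le hr (hl.1.trans_lt hlD)
    (eventually_quantError_lt_one hr hK.totallyBounded hμK)

variable [BorelSpace E]

lemma IsCondensationAttractor.ae_mem_of_measure_eq_one (hK : IsCondensationAttractor S C K)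
    (hμ : μ C = 1) : ∀ᵐ x ∂μ, x ∈ K := by
  have hCK : C ⊆ K := hK.2 ▸ Set.subset_union_right
  exact (prob_compl_eq_zero_iff hK.1.measurableSet).2
    (le_antisymm prob_le_one (hμ.symm.trans_le (measure_mono hCK)))

lemma IsCondensationMeasure.ae_mem [IsProbabilityMeasure ν] (hμ : IsCondensationMeasure S p ν μ)
    (hp : IsProbVector p) (hK : IsCondensationAttractor S C K) (hS : ∀ i, Continuous (S i))
    (hν : ν C = 1) : ∀ᵐ x ∂μ, x ∈ K := by
  have hp1 := hp.sum_succ_lt_one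
  lift p to Fin (N + 1) → ℝ≥0 using fun i => (hp.1 i).le
  beta_reduce at hp1
  simp only [IsCondensationMeasure, ENNReal.ofReal_coe_nnreal] at hμ
  exact ae_mem_of_le_add_sum_map hK.1.measurableSet (fun i => (hS i).measurable) hK.mapsTo
    (mod_cast hp1) (Measure.ae_smul_measure (hK.ae_mem_of_measure_eq_one hν) _) hμ.le

lemma IsCondensationMeasure.coe_le_lowerQuantDim (hμ : IsCondensationMeasure S p ν μ)
    (hr : 0 < r) (hN : 1 ≤ N) (hp : IsProbVector p) {s : Fin N → ℝ} (hs : ∀ i, 0 < s i)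
    (hs1 : ∀ i, s i < 1) (hS : ∀ i, Continuous (S i))
    (hSs : ∀ i x y, s i * dist x y ≤ dist (S i x) (S i y)) (hK : IsCompact K)
    (hdisj : ∀ i j, i ≠ j → Disjoint (S i '' K) (S j '' K)) (hμK : ∀ᵐ x ∂μ, x ∈ K) {k : ℝ}
    (hk : IsDimSolution r (fun i => p i.succ) s k) : (k : EReal) ≤ lowerQuantDim r μ := by
  rcases hk.1.eq_or_lt with rfl | hk0
  · exact lowerQuantDim_nonneg hr (eventually_quantError_lt_one hr hK.totallyBounded hμK)
  have hps : ∀ i, p i.succ * s i ^ r < 1 :=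
    lt_one_of_sum_lt_one (fun i => mul_nonneg (hp.1 _).le (Real.rpow_nonneg (hs i).le r))
      (sum_mul_rpow_lt_one hr hN (fun i => hp.1 i.succ) hp.sum_succ_lt_one.le hs hs1)
  have hsum := hk.2
  rw [div_add_eq_inv_one_add_div hk0.ne'] at hsum
  lift p to Fin (N + 1) → ℝ≥0 using fun i => (hp.1 i).le
  lift s to Fin N → ℝ≥0 using fun i => (hs i).le
  beta_reduce at hsum
  simp only [IsCondensationMeasure, ENNReal.ofReal_coe_nnreal] at hμ
  have hanti (i : Fin N) : AntilipschitzWith (s i)⁻¹ (S i) := by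
    refine .of_le_mul_dist fun x y => ?_
    rw [NNReal.coe_inv, le_inv_mul_iff₀ (hs i)]
    exact hSs i x y
  exact coe_le_lowerQuantDim_of_sum_smul_map_le (p := fun i => p i.succ) hr hk0
    (fun i => (mod_cast hs i : 0 < s i).ne') (fun i => mod_cast (hs1 i).le)
    (fun i => (mod_cast hp.1 i.succ : 0 < p i.succ).ne') (fun i => mod_cast hps i)
    (mod_cast hsum) hS hanti hK hdisj hμK ((Measure.le_add_left le_rfl).trans_eq hμ.symm)

end Condensation

end CondQuant

open CondQuant in
theorem theorem1p1_general {E : Type*} [NormedAddCommGroup E] [MeasurableSpace E] [BorelSpace E]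
    {r : ℝ} (hr : 0 < r) {N : ℕ} (hN : 1 ≤ N) {S : Fin N → E → E} {s c : Fin N → ℝ}
    (hs : ∀ i, 0 < s i) (hsc : ∀ i, s i ≤ c i) (hc : ∀ i, c i < 1)
    (hS : ∀ i x y, s i * dist x y ≤ dist (S i x) (S i y) ∧ dist (S i x) (S i y) ≤ c i * dist x y)
    {p : Fin (N + 1) → ℝ} (hp : IsProbVector p) {C K : Set E} {ν μ : Measure E}
    [IsProbabilityMeasure ν] [IsProbabilityMeasure μ] (hν : ν C = 1)
    (hμ : IsCondensationMeasure S p ν μ) (hK : IsCondensationAttractor S C K)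
    (hdisj : ∀ i j, i ≠ j → Disjoint (S i '' K) (S j '' K)) :
    ((∃! k : ℝ, IsDimSolution r (fun i => p i.succ) s k) ∧
      ∀ k : ℝ, IsDimSolution r (fun i => p i.succ) s k →
        max (k : EReal) (lowerQuantDim r ν) ≤ lowerQuantDim r μ) ∧
    ∀ (M : ℕ) (g : Fin M → E → E) (ρ t : Fin M → ℝ),
      (∀ j, 0 < ρ j ∧ ρ j < 1) →
      (∀ j x y, dist (g j x) (g j y) ≤ ρ j * dist x y) →
      IsProbVector t →
      IsInvariantMeasure g t ν →
      (∃! l : ℝ, IsDimSolution r (fun i => p i.succ) c l) ∧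
      (∃! d : ℝ, IsDimSolution r t ρ d) ∧
      ∀ l d : ℝ, IsDimSolution r (fun i => p i.succ) c l → IsDimSolution r t ρ d →
        upperQuantDim r μ ≤ max (l : EReal) (d : EReal) := by
  have hc0 : ∀ i, 0 < c i := fun i => (hs i).trans_le (hsc i)
  have hs1 : ∀ i, s i < 1 := fun i => (hsc i).trans_lt (hc i)
  have hSc : ∀ i, Continuous (S i) := fun i =>
    (LipschitzWith.of_dist_le' fun x y => (hS i x y).2).continuous
  have hp0 : ∀ i : Fin N, 0 < p i.succ := fun i => hp.1 i.succ
  have hp1 := hp.sum_succ_lt_one.le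
  have hνK := hK.ae_mem_of_measure_eq_one hν
  have hμK := hμ.ae_mem hp hK hSc hν
  refine ⟨⟨existsUnique_isDimSolution hr hN hp0 hp1 hs hs1, fun k hk => max_le ?_ ?_⟩,
    fun M g ρ t hρ hg ht hνg => ⟨existsUnique_isDimSolution hr hN hp0 hp1 hc0 hc,
      existsUnique_isDimSolution hr ht.one_le_card ht.1 ht.2.le (fun j => (hρ j).1)
        fun j => (hρ j).2, fun l d hl hd => ?_⟩⟩
  · exact hμ.coe_le_lowerQuantDim hr hN hp hs hs1 hSc (fun i x y => (hS i x y).1) hK.1 hdisj hμK hk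
  · exact hμ.lowerQuantDim_le hr hp hK.1 hμK
  · exact hμ.upperQuantDim_le hr hN hp hc0 hc (fun i x y => (hS i x y).2) hK.1 hνK hμK
      (fun j => (hρ j).1) (fun j => (hρ j).2) hg ht hνg hl hd

theorem theorem1p1 {E : Type*} [NormedAddCommGroup E] [NormedSpace ℝ E] [FiniteDimensional ℝ E]
    [MeasurableSpace E] [BorelSpace E]
    (r : ℝ) (hr : 0 < r)
    (N : ℕ) (hN : 1 ≤ N) (S : Fin N → E → E) (s c : Fin N → ℝ)
    (hs : ∀ i, 0 < s i) (hsc : ∀ i, s i ≤ c i) (hc : ∀ i, c i < 1)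
    (hS : ∀ i x y, s i * dist x y ≤ dist (S i x) (S i y) ∧ dist (S i x) (S i y) ≤ c i * dist x y)
    (p : Fin (N + 1) → ℝ) (hp : CondQuant.IsProbVector p)
    (C : Set E) (hC : IsCompact C)
    (ν : MeasureTheory.Measure E) [MeasureTheory.IsProbabilityMeasure ν] (hν : ν C = 1)
    (μ : MeasureTheory.Measure E) [MeasureTheory.IsProbabilityMeasure μ]
    (hμ : CondQuant.IsCondensationMeasure S p ν μ)
    (hsep : CondQuant.StrongSeparation S C) :
    ((∃! k : ℝ, CondQuant.IsDimSolution r (fun i => p i.succ) s k) ∧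
      ∀ k : ℝ, CondQuant.IsDimSolution r (fun i => p i.succ) s k →
        max (k : EReal) (CondQuant.lowerQuantDim r ν) ≤ CondQuant.lowerQuantDim r μ) ∧
    ∀ (M : ℕ) (g : Fin M → E → E) (ρ t : Fin M → ℝ),
      (∀ j, 0 < ρ j ∧ ρ j < 1) →
      (∀ j x y, dist (g j x) (g j y) ≤ ρ j * dist x y) →
      CondQuant.StrongOpenSetCondition g →
      CondQuant.IsProbVector t →
      CondQuant.IsInvariantMeasure g t ν →
      (∃! l : ℝ, CondQuant.IsDimSolution r (fun i => p i.succ) c l) ∧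
      (∃! d : ℝ, CondQuant.IsDimSolution r t ρ d) ∧
      ∀ l d : ℝ, CondQuant.IsDimSolution r (fun i => p i.succ) c l →
        CondQuant.IsDimSolution r t ρ d →
        CondQuant.upperQuantDim r μ ≤ max (l : EReal) (d : EReal) := by
  obtain ⟨K, hK, hdisj, -⟩ := hsep
  have h := theorem1p1_general hr hN hs hsc hc hS hp hν hμ hK hdisj
  exact ⟨h.1, fun M g ρ t hρ hg _ => h.2 M g ρ t hρ hg⟩
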